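/- **Conventions.** *Machines* are multi-tape Turing machines with a read-only two-way input tape (whose head stays on the input word and its two end markers) and finitely many work tapes, which stop in an accepting state, in a rejecting state, or without an answer. The time used on an input is the number of steps, the space is the number of work tape cells visited, and a bound on either has to hold for all computations on that input. On an input $w$ a machine *answers "yes"* if some computation on $w$ ends in the accepting state, and it *answers "no"* if all computations on $w$ terminate, each of them in the rejecting state. A *complexity class* $\mathcal C$ is given by a mode of computation (deterministic or nondeterministic), by the resources that are controlled (time, space, or both), and, for each controlled resource, by a collection of nondecreasing functions $f:\mathbb N\to\mathbb N$ with $f>0$ such that for every $f$ in the collection and every integer $c\ge 1$ the function $n\mapsto c\,f(cn+c)+c$ is also in the collection. Let $X$ be a finite alphabet, $D\subseteq X^*$ and $S\subseteq X^*$. We say that $D$ is *solvable in $\mathcal C$ on $S$* if there are a machine of the given mode and, for each controlled resource, one function $f$ from its collection, such that (i) on every input $w\in X^*$, each answer "yes" or "no" that the machine gives to the question whether $w\in D$ is correct, and (ii) on every $w\in S$ all computations terminate, the machine gives an answer, and it uses at most $f(|w|)$ of each controlled resource. The problem $D$ is *in $\mathcal C$* if it is solvable in $\mathcal C$ on $X^*$.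 For $S\subseteq X^*$ let $\rho_n(S)$ be the proportion of words in $S$ among all words in $X^*$ of length at most $n$. The set $S$ is *generic* if $\rho_n(S)\to 1$, and *strongly generic* if in addition there are $K>0$ and $0\le\sigma<1$ with $1-\rho_n(S)\le K\sigma^n$ for all $n\ge 1$. The problem $D$ is *generically in $\mathcal C$* (*strongly generically in $\mathcal C$*) if it is solvable in $\mathcal C$ on some generic (strongly generic) set $S$. For a group $G$ and a finite generating tuple $A=(a_1,\dots,a_k)$ of $G$, the word problem $WP(G,A)$ is the set of words over the $2k$ letters $a_1^{\pm1},\dots,a_k^{\pm1}$ that represent $1$ in $G$. The word problem of $G$ is *in $\mathcal C$* (*generically in $\mathcal C$*, *strongly generically in $\mathcal C$*) if $WP(G,A)$ is so for every finite generating tuple $A$ of $G$. **Theorem A.** Let $G$ be a finitely generated group and let $\mathcal C$ be a complexity class. Suppose that some subgroup of finite index in $G$ has an infinite quotient group $\overline G$ whose word problem is in $\mathcal C$. Then the word problem of $G$ is generically in $\mathcal C$. Moreover, if $\overline G$ is non-amenable, then the word problem of $G$ is strongly generically in $\mathcal C$. -/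

import Mathlib

namespace GenericComplexity

/-! ### Multi-tape Turing machines -/

/-- A head movement. -/
inductive Move
  | left
  | stay
  | right

/-- What the input head sees: one of the two end markers or a letter of the input word. -/
inductive InputSymbol (X : Type)
  | leftEnd
  | letter (x : X)
  | rightEnd

/-- The symbol at position `p` of the input tape: position `0` holds the left end marker,
positions `1, …, |w|` hold the letters of `w`, and `|w| + 1` holds the right end marker. -/
def inputAt {X : Type} (w : List X) : ℕ → InputSymbol X
  | 0 => .leftEnd
  | p + 1 =>
    match w[p]? with
    | some x => .letter x
    | none => .rightEnd

/-- Movement of the input head; it never leaves the input word and its two end markers. -/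
def moveInput (n : ℕ) : Move → ℕ → ℕ
  | .left, p => p - 1
  | .stay, p => p
  | .right, p => min (p + 1) (n + 1)

/-- A two-way infinite work tape, of which only the (finite) part visited so far is recorded:
`left` is the part to the left of the head, nearest cell first, and `right` is the part to the
right of the head, nearest cell first. Cells that have not been visited are blank. -/
structure WorkTape (Γ : Type) where
  left : List Γ
  head : Γ
  right : List Γ

namespace WorkTape

/-- The number of cells visited so far. -/
def size {Γ : Type} (T : WorkTape Γ) : ℕ := T.left.length + 1 + T.right.length

/-- Move the head; a newly visited cell is blank. -/
def move {Γ : Type} (blank : Γ) : Move → WorkTape Γ → WorkTape Γ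
  | .stay, T => T
  | .left, ⟨[], a, r⟩ => ⟨[], blank, a :: r⟩
  | .left, ⟨b :: l, a, r⟩ => ⟨l, b, a :: r⟩
  | .right, ⟨l, a, []⟩ => ⟨a :: l, blank, []⟩
  | .right, ⟨l, a, b :: r⟩ => ⟨a :: l, b, r⟩

/-- Write a symbol at the head. -/
def write {Γ : Type} (a : Γ) (T : WorkTape Γ) : WorkTape Γ := { T with head := a }

end WorkTape

/-- A (possibly nondeterministic) multi-tape Turing machine with a read-only two-way input tape
over the alphabet `X` and `numTapes` work tapes. The set `delta q s g` lists the instructions that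
apply in state `q` when the input head sees `s` and the work heads see `g`: a new state, a
movement of the input head and, for each work tape, a symbol to write and a movement. The machine
stops in the states `accept` and `reject`, and also (without an answer) when no instruction
applies. -/
structure Machine (X : Type) where
  State : Type
  finite_state : Finite State
  Sym : Type
  finite_sym : Finite Sym
  blank : Sym
  numTapes : ℕ
  start : State
  accept : State
  reject : State
  accept_ne_reject : accept ≠ reject
  delta : State → InputSymbol X → (Fin numTapes → Sym) →
    Set (State × Move × (Fin numTapes → Sym × Move))

namespace Machine

variable {X : Type}

/-- A configuration: the state, the position of the input head and the work tapes. -/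
structure Config (M : Machine X) where
  state : M.State
  pos : ℕ
  tapes : Fin M.numTapes → WorkTape M.Sym

/-- The number of work tape cells visited up to a configuration, over all work tapes. -/
def Config.space {M : Machine X} (c : M.Config) : ℕ := ∑ i, (c.tapes i).size

/-- The initial configuration: input head on the left end marker, blank work tapes. -/
def init (M : Machine X) : M.Config where
  state := M.start
  pos := 0
  tapes := fun _ => ⟨[], M.blank, []⟩

/-- One step of a computation on the input `w`. -/
def Step (M : Machine X) (w : List X) (c c' : M.Config) : Prop :=
  c.state ≠ M.accept ∧ c.state ≠ M.reject ∧
    ∃ a ∈ M.delta c.state (inputAt w c.pos) (fun i => (c.tapes i).head),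
      c' = { state := a.1
             pos := moveInput w.length a.2.1 c.pos
             tapes := fun i =>
               WorkTape.move M.blank (a.2.2 i).2 ((c.tapes i).write (a.2.2 i).1) }

/-- `M.Reaches w n c`: some computation of `M` on the input `w` is in configuration `c` after
exactly `n` steps. -/
inductive Reaches (M : Machine X) (w : List X) : ℕ → M.Config → Prop
  | init : Reaches M w 0 M.init
  | step {n : ℕ} {c c' : M.Config} : Reaches M w n c → M.Step w c c' → Reaches M w (n + 1) c'

/-- Every computation of `M` on `w` has at most `N` steps. -/
def RunsInTime (M : Machine X) (w : List X) (N : ℕ) : Prop :=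
  ∀ n c, M.Reaches w n c → n ≤ N

/-- Every computation of `M` on `w` visits at most `N` work tape cells. -/
def RunsInSpace (M : Machine X) (w : List X) (N : ℕ) : Prop :=
  ∀ n c, M.Reaches w n c → c.space ≤ N

/-- All computations of `M` on `w` terminate. -/
def Halts (M : Machine X) (w : List X) : Prop := ∃ N, M.RunsInTime w N

/-- `M` answers "yes" on `w`: some computation ends in the accepting state. -/
def Accepts (M : Machine X) (w : List X) : Prop :=
  ∃ n c, M.Reaches w n c ∧ c.state = M.accept

/-- `M` answers "no" on `w`: all computations terminate, each of them in the rejecting state. -/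
def Rejects (M : Machine X) (w : List X) : Prop :=
  M.Halts w ∧ ∀ n c, M.Reaches w n c → (∀ c', ¬ M.Step w c c') → c.state = M.reject

/-- `M` is a correct partial algorithm for `D`: each definite answer that it gives is right. -/
def IsCorrectFor (M : Machine X) (D : Set (List X)) : Prop :=
  ∀ w, (M.Accepts w → w ∈ D) ∧ (M.Rejects w → w ∉ D)

/-- At most one instruction applies in each situation. -/
def IsDeterministic (M : Machine X) : Prop := ∀ q s g, (M.delta q s g).Subsingleton

end Machine

/-! ### Complexity classes -/

/-- The mode of computation. -/
inductive Mode
  | deterministic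
  | nondeterministic

/-- The machine is allowed in the given mode. -/
def Machine.HasMode {X : Type} (M : Machine X) : Mode → Prop
  | .deterministic => M.IsDeterministic
  | .nondeterministic => True

/-- An admissible collection of resource bounds: positive nondecreasing functions, closed under
`f ↦ (n ↦ c * f (c * n + c) + c)` for every integer `c ≥ 1`. (Constructibility of the bounds is
not required, so collections of proper complexity functions are a special case.) -/
def IsBoundFamily (F : Set (ℕ → ℕ)) : Prop :=
  ∀ f ∈ F, Monotone f ∧ (∀ n, 0 < f n) ∧
    ∀ c : ℕ, 1 ≤ c → (fun n => c * f (c * n + c) + c) ∈ F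

/-- The data that determine a complexity class: a mode of computation and, for each of the
resources time and space, either a collection of bounds or `none`, if it is not controlled. -/
structure ComplexityClass where
  mode : Mode
  time : Option (Set (ℕ → ℕ))
  space : Option (Set (ℕ → ℕ))
  time_bounds : ∀ F ∈ time, IsBoundFamily F
  space_bounds : ∀ F ∈ space, IsBoundFamily F

/-- Some correct partial algorithm for `D`, of the right mode, terminates with a definite answer
within the resource bounds of `C` on every input from `S`. -/
def ComplexityClass.SolvesOn (C : ComplexityClass) {X : Type} (D S : Set (List X)) : Prop :=
  ∃ M : Machine X, M.HasMode C.mode ∧ M.IsCorrectFor D ∧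
    (∀ w ∈ S, M.Halts w ∧ (M.Accepts w ∨ M.Rejects w)) ∧
    (∀ F ∈ C.time, ∃ f ∈ F, ∀ w ∈ S, M.RunsInTime w (f w.length)) ∧
    (∀ F ∈ C.space, ∃ f ∈ F, ∀ w ∈ S, M.RunsInSpace w (f w.length))

/-- The decision problem `D` belongs to the class `C`. -/
def ComplexityClass.Contains (C : ComplexityClass) {X : Type} (D : Set (List X)) : Prop :=
  C.SolvesOn D Set.univ

/-! ### Genericity -/

/-- The proportion of words in `S` among all words of length at most `n`. -/
noncomputable def density {X : Type} (S : Set (List X)) (n : ℕ) : ℝ :=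
  ({w : List X | w ∈ S ∧ w.length ≤ n}.ncard : ℝ) / ({w : List X | w.length ≤ n}.ncard : ℝ)

/-- Generic sets of words: the asymptotic density exists and is `1`. -/
def IsGeneric {X : Type} (S : Set (List X)) : Prop :=
  Filter.Tendsto (density S) Filter.atTop (nhds 1)

/-- Strongly generic sets of words: the density tends to `1` exponentially fast. -/
def IsStronglyGeneric {X : Type} (S : Set (List X)) : Prop :=
  IsGeneric S ∧ ∃ σ K : ℝ, 0 ≤ σ ∧ σ < 1 ∧ 0 < K ∧ ∀ n : ℕ, 1 ≤ n → 1 - density S n ≤ K * σ ^ n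

/-- `D` has generic-case complexity `C`. -/
def ComplexityClass.GenericallyContains (C : ComplexityClass) {X : Type}
    (D : Set (List X)) : Prop :=
  ∃ S : Set (List X), IsGeneric S ∧ C.SolvesOn D S

/-- `D` has generic-case complexity strongly `C`. -/
def ComplexityClass.StronglyGenericallyContains (C : ComplexityClass) {X : Type}
    (D : Set (List X)) : Prop :=
  ∃ S : Set (List X), IsStronglyGeneric S ∧ C.SolvesOn D S

/-! ### Word problems -/

/-- The element represented by a word in the generators `π i` and their formal inverses; the
letter `(i, true)` stands for `π i` and `(i, false)` for its inverse. -/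
def evalWord {G : Type*} [Group G] {k : ℕ} (π : Fin k → G) (w : List (Fin k × Bool)) : G :=
  (w.map fun x => if x.2 then π x.1 else (π x.1)⁻¹).prod

/-- `π` is a finite generating tuple of `G`. -/
def Generates {G : Type*} [Group G] {k : ℕ} (π : Fin k → G) : Prop :=
  Subgroup.closure (Set.range π) = ⊤

/-- The word problem of `G` with respect to `π`. -/
def wordProblem {G : Type*} [Group G] {k : ℕ} (π : Fin k → G) : Set (List (Fin k × Bool)) :=
  {w | evalWord π w = 1}

/-- The word problem of `G` is in `C`, for every finite generating tuple. -/
def WordProblemIn (C : ComplexityClass) (G : Type*) [Group G] : Prop :=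
  ∀ (k : ℕ) (π : Fin k → G), Generates π → C.Contains (wordProblem π)

/-- The word problem of `G` is generically in `C`, for every finite generating tuple. -/
def WordProblemGenericallyIn (C : ComplexityClass) (G : Type*) [Group G] : Prop :=
  ∀ (k : ℕ) (π : Fin k → G), Generates π → C.GenericallyContains (wordProblem π)

/-- The word problem of `G` is strongly generically in `C`, for every finite generating tuple. -/
def WordProblemStronglyGenericallyIn (C : ComplexityClass) (G : Type*) [Group G] : Prop :=
  ∀ (k : ℕ) (π : Fin k → G), Generates π → C.StronglyGenericallyContains (wordProblem π)

/-! ### Amenability -/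

/-- A discrete group is amenable if it has a left-invariant finitely additive probability measure
defined on all subsets. -/
def IsAmenable (G : Type*) [Group G] : Prop :=
  ∃ m : Set G → ℝ, (∀ s, 0 ≤ m s) ∧ m Set.univ = 1 ∧
    (∀ s t, Disjoint s t → m (s ∪ t) = m s + m t) ∧
    ∀ (g : G) (s : Set G), m ((fun x => g * x) '' s) = m s

end GenericComplexity

/-!
Let `Q` be an infinite quotient of a subgroup `H` of finite index in `G`, and let `N ≤ H` be the
kernel of `H → Q`. Reidemeister–Schreier rewriting turns a word over the generators of `G` letter by
letter into a word over generators of `Q`, and a word that represents `1` in `G` becomes one that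
represents `1` in `Q`. The rewriting automaton is reversible, so a machine for the word problem of
`Q` can keep track of its state while moving over the input in both directions, and run on the
rewritten word without writing it down. Its answer "no" is correct for `G`; the answer "yes" tells
nothing and is suppressed.

The words without an answer are those that move the base point of the infinite coset space `G ⧸ N`
into a fixed finite set, so their proportion is bounded by return probabilities of the random walk
on `G ⧸ N`. Its Markov operator on `ℓ²(G ⧸ N)` is a symmetric contraction that preserves the norm of
no nonzero vector, hence its powers tend to `0` strongly and the set of answered words is generic.
If `Q` is non-amenable, then `G ⧸ N` carries no invariant mean, and the norm of the Markov operator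
is less than `1` by Kesten's criterion; the proportion then decays exponentially.
-/

namespace GenericComplexity

open Filter Topology Pointwise

/-! ### Averages of isometries -/

section SymmetricContraction

variable {E : Type*} [NormedAddCommGroup E] [InnerProductSpace ℝ E] {T : E →L[ℝ] E}

lemma inner_pow_apply (hT : (T : E →ₗ[ℝ] E).IsSymmetric) (m n : ℕ) (v w : E) :
    inner ℝ ((T ^ (m + n)) v) w = inner ℝ ((T ^ m) v) ((T ^ n) w) := by
  have hn := hT.pow n ((T ^ m) v) w
  rw [← ContinuousLinearMap.toLinearMap_pow] at hn
  rw [add_comm, pow_add]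
  exact hn

lemma norm_pow_apply_sub_sq (hT : (T : E →ₗ[ℝ] E).IsSymmetric) (m n : ℕ) (v : E) :
    ‖(T ^ (2 * m)) v - (T ^ (2 * n)) v‖ ^ 2 =
      ‖(T ^ (2 * m)) v‖ ^ 2 - 2 * ‖(T ^ (m + n)) v‖ ^ 2 + ‖(T ^ (2 * n)) v‖ ^ 2 := by
  have hinner : inner ℝ ((T ^ (2 * m)) v) ((T ^ (2 * n)) v) = ‖(T ^ (m + n)) v‖ ^ 2 := by
    rw [← inner_pow_apply hT, show 2 * m + 2 * n = (m + n) + (m + n) by ring,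
      inner_pow_apply hT, real_inner_self_eq_norm_sq]
  rw [norm_sub_sq_real, hinner]

lemma antitone_norm_pow_apply (hle : ∀ v, ‖T v‖ ≤ ‖v‖) (v : E) :
    Antitone fun n => ‖(T ^ n) v‖ :=
  antitone_nat_of_succ_le fun n => by
    rw [pow_succ']
    exact hle _

lemma cauchySeq_pow_two_mul_apply (hT : (T : E →ₗ[ℝ] E).IsSymmetric) {v : E} {c : ℝ}
    (hc : Tendsto (fun n => ‖(T ^ n) v‖) atTop (𝓝 c)) : CauchySeq fun n => (T ^ (2 * n)) v := by
  rw [cauchySeq_iff_tendsto_dist_atTop_0, ← prod_atTop_atTop_eq]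
  have heven : Tendsto (fun n : ℕ => 2 * n) atTop atTop := tendsto_id.const_mul_atTop' two_pos
  have hadd : Tendsto (fun p : ℕ × ℕ => p.1 + p.2) (atTop ×ˢ atTop) atTop :=
    tendsto_fst.atTop_add_atTop tendsto_snd
  have hlim := (((hc.comp (heven.comp tendsto_fst)).pow 2).sub
    (((hc.comp hadd).pow 2).const_mul 2)).add ((hc.comp (heven.comp tendsto_snd)).pow 2)
  have hlim_zero := hlim.sqrt
  rw [show c ^ 2 - 2 * c ^ 2 + c ^ 2 = 0 by ring, Real.sqrt_zero] at hlim_zero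
  refine hlim_zero.congr fun p => ?_
  rw [dist_eq_norm, ← Real.sqrt_sq (norm_nonneg _), norm_pow_apply_sub_sq hT]
  rfl

/-- The even iterates converge, and `T` preserves the norm of their limit. -/
lemma tendsto_pow_apply_zero [CompleteSpace E] (hT : (T : E →ₗ[ℝ] E).IsSymmetric)
    (hle : ∀ v, ‖T v‖ ≤ ‖v‖) (hlt : ∀ v, ‖T v‖ = ‖v‖ → v = 0) (v : E) :
    Tendsto (fun n => (T ^ n) v) atTop (𝓝 0) := by
  obtain ⟨c, hc⟩ : ∃ c, Tendsto (fun n => ‖(T ^ n) v‖) atTop (𝓝 c) :=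
    ⟨_, tendsto_atTop_ciInf (antitone_norm_pow_apply hle v)
      ⟨0, Set.forall_mem_range.2 fun _ => norm_nonneg _⟩⟩
  have heven : Tendsto (fun n : ℕ => 2 * n) atTop atTop := tendsto_id.const_mul_atTop' two_pos
  obtain ⟨g, hg⟩ := cauchySeq_tendsto_of_complete (cauchySeq_pow_two_mul_apply hT hc)
  have hgc : ‖g‖ = c := tendsto_nhds_unique hg.norm (hc.comp heven)
  have hTgc : ‖T g‖ = c := by
    refine tendsto_nhds_unique ((T.continuous.tendsto g).comp hg).norm ?_
    refine (hc.comp ((tendsto_add_atTop_nat 1).comp heven)).congr fun n => ?_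
    simp only [Function.comp_apply, pow_succ', mul_apply_eq_comp]
  have hc0 : c = 0 := by rw [← hgc, hlt g (hTgc.trans hgc.symm), norm_zero]
  exact tendsto_zero_iff_norm_tendsto_zero.2 (hc0 ▸ hc)

end SymmetricContraction

section AverageOperator

variable {E : Type*} [NormedAddCommGroup E] [InnerProductSpace ℝ E] {X : Type*} [Fintype X]

lemma sum_sum_norm_sub_sq (v : X → E) :
    ∑ x, ∑ x', ‖v x - v x'‖ ^ 2 = 2 * (Fintype.card X * ∑ x, ‖v x‖ ^ 2 - ‖∑ x, v x‖ ^ 2) := by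
  have hinner : ∑ x, ∑ x', inner ℝ (v x) (v x') = ‖∑ x, v x‖ ^ 2 := by
    rw [← real_inner_self_eq_norm_sq, sum_inner]
    exact Finset.sum_congr rfl fun x _ => (inner_sum _ _ _).symm
  simp only [norm_sub_sq_real, Finset.sum_add_distrib, Finset.sum_sub_distrib, ← Finset.mul_sum,
    hinner, Finset.sum_const, Finset.card_univ, nsmul_eq_mul]
  ring

/-- The average of finitely many isometries, the Markov operator of a random walk whose steps are
uniformly distributed over these. -/
noncomputable def averageOperator (U : X → E ≃ₗᵢ[ℝ] E) : E →L[ℝ] E :=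
  (Fintype.card X : ℝ)⁻¹ • ∑ x, ((U x).toContinuousLinearEquiv : E →L[ℝ] E)

variable (U : X → E ≃ₗᵢ[ℝ] E)

lemma averageOperator_apply (v : E) :
    averageOperator U v = (Fintype.card X : ℝ)⁻¹ • ∑ x, U x v := by
  simp [averageOperator]

lemma norm_averageOperator_apply_le (v : E) : ‖averageOperator U v‖ ≤ ‖v‖ := by
  rw [averageOperator_apply, norm_smul, norm_inv, Real.norm_natCast]
  refine inv_mul_le_of_le_mul₀ (Nat.cast_nonneg _) (norm_nonneg v) ?_
  simpa using norm_sum_le Finset.univ fun x => U x v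

lemma norm_sub_sq_le_of_averageOperator (v : E) (x x' : X) :
    ‖U x v - U x' v‖ ^ 2 ≤
      2 * (Fintype.card X : ℝ) ^ 2 * (‖v‖ ^ 2 - ‖averageOperator U v‖ ^ 2) := by
  have hcard : (Fintype.card X : ℝ) ≠ 0 :=
    Nat.cast_ne_zero.2 (Fintype.card_pos_iff.2 ⟨x⟩).ne'
  calc ‖U x v - U x' v‖ ^ 2
      ≤ ∑ x', ‖U x v - U x' v‖ ^ 2 :=
        Finset.single_le_sum (f := fun x' => ‖U x v - U x' v‖ ^ 2) (fun _ _ => by positivity)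
          (Finset.mem_univ x')
    _ ≤ ∑ x, ∑ x', ‖U x v - U x' v‖ ^ 2 :=
        Finset.single_le_sum (f := fun x => ∑ x', ‖U x v - U x' v‖ ^ 2)
          (fun _ _ => by positivity) (Finset.mem_univ x)
    _ = 2 * (Fintype.card X : ℝ) ^ 2 * (‖v‖ ^ 2 - ‖averageOperator U v‖ ^ 2) := by
        rw [sum_sum_norm_sub_sq, averageOperator_apply, norm_smul, norm_inv, Real.norm_natCast]
        simp only [LinearIsometryEquiv.norm_map, Finset.sum_const, Finset.card_univ, nsmul_eq_mul]
        field_simp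

lemma apply_eq_apply_of_norm_averageOperator_eq {v : E} (h : ‖averageOperator U v‖ = ‖v‖)
    (x x' : X) : U x v = U x' v := by
  have hle := norm_sub_sq_le_of_averageOperator U v x x'
  rw [h, sub_self, mul_zero] at hle
  exact sub_eq_zero.1 (norm_eq_zero.1 (pow_eq_zero_iff two_ne_zero |>.1
    (hle.antisymm (sq_nonneg _))))

lemma isSymmetric_averageOperator {σ : Equiv.Perm X} (hσ : ∀ x, U (σ x) = (U x)⁻¹) :
    (averageOperator U : E →ₗ[ℝ] E).IsSymmetric := by
  intro v w
  have hflip : ∀ x, inner ℝ (U x v) w = inner ℝ v (U (σ x) w) := fun x => by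
    rw [hσ, LinearIsometryEquiv.inner_map_eq_flip]
    rfl
  simp only [ContinuousLinearMap.coe_coe, averageOperator_apply, inner_smul_left, inner_smul_right,
    sum_inner, inner_sum, hflip, Equiv.sum_comp σ fun x => inner ℝ v (U x w), conj_trivial]

lemma exists_norm_eq_one_forall_norm_sub_lt (h : 1 ≤ ‖averageOperator U‖) {ε : ℝ} (hε : 0 < ε) :
    ∃ v : E, ‖v‖ = 1 ∧ ∀ x x', ‖U x v - U x' v‖ < ε := by
  obtain ⟨r, hr, hr_lt⟩ : ∃ r : NNReal,
      2 * (Fintype.card X : ℝ) ^ 2 * (1 - (r : ℝ) ^ 2) < ε ^ 2 ∧ r < 1 := by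
    have hcont : Continuous fun r : NNReal =>
        2 * (Fintype.card X : ℝ) ^ 2 * (1 - (r : ℝ) ^ 2) := by fun_prop
    have hnear : ∀ᶠ r : NNReal in 𝓝[<] 1,
        2 * (Fintype.card X : ℝ) ^ 2 * (1 - (r : ℝ) ^ 2) < ε ^ 2 :=
      nhdsWithin_le_nhds ((hcont.tendsto 1).eventually_lt_const (by simpa using pow_pos hε 2))
    have : (𝓝[<] (1 : NNReal)).NeBot := nhdsLT_neBot_of_exists_lt ⟨0, one_pos⟩
    exact (hnear.and self_mem_nhdsWithin).exists
  obtain ⟨v, hv, hrv⟩ :=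
    (averageOperator U).exists_nnnorm_eq_one_lt_apply_of_lt_opNNNorm (hr_lt.trans_le h)
  have hv' : ‖v‖ = 1 := congrArg NNReal.toReal hv
  have hrv' : (r : ℝ) ≤ ‖averageOperator U v‖ := hrv.le
  refine ⟨v, hv', fun x x' => lt_of_pow_lt_pow_left₀ 2 hε.le ?_⟩
  calc ‖U x v - U x' v‖ ^ 2
      ≤ 2 * (Fintype.card X : ℝ) ^ 2 * (‖v‖ ^ 2 - ‖averageOperator U v‖ ^ 2) :=
        norm_sub_sq_le_of_averageOperator U v x x'
    _ ≤ 2 * (Fintype.card X : ℝ) ^ 2 * (1 - (r : ℝ) ^ 2) := by rw [hv', one_pow]; gcongr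
    _ < ε ^ 2 := hr

end AverageOperator

/-! ### Square summable functions and means -/

section EllTwo

/-- The Hilbert space `ℓ²(Y)` of square summable real functions on `Y`. -/
abbrev EllTwo (Y : Type*) : Type _ := ↥(lp (fun _ : Y => ℝ) 2)

variable {Y : Type*}

lemma memℓp_two_iff {f : Y → ℝ} : Memℓp f 2 ↔ Summable fun y => f y ^ 2 := by
  rw [memℓp_gen_iff (by simp)]
  simp

lemma hasSum_sq (v : EllTwo Y) : HasSum (fun y => v y ^ 2) (‖v‖ ^ 2) := by
  simpa [← pow_two] using lp.hasSum_inner (𝕜 := ℝ) v v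

/-- The square summable function with given values. -/
def EllTwo.mk {f : Y → ℝ} (hf : Summable fun y => f y ^ 2) : EllTwo Y := ⟨f, memℓp_two_iff.2 hf⟩

@[simp] lemma EllTwo.mk_apply {f : Y → ℝ} (hf : Summable fun y => f y ^ 2) (y : Y) :
    EllTwo.mk hf y = f y := rfl

@[ext] lemma EllTwo.ext {v w : EllTwo Y} (h : ∀ y, v y = w y) : v = w := lp.ext (funext h)

lemma indicator_sq (s : Set Y) (f : Y → ℝ) (y : Y) :
    s.indicator f y ^ 2 = s.indicator (fun y => f y ^ 2) y := by
  by_cases hy : y ∈ s <;> simp [hy]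

/-- The projection of `ℓ²(Y)` to the functions that vanish outside `s`. -/
noncomputable def restrict (s : Set Y) : EllTwo Y →ₗ[ℝ] EllTwo Y where
  toFun v := EllTwo.mk (f := s.indicator v) <| by
    simpa only [indicator_sq] using (hasSum_sq v).summable.indicator s
  map_add' v w := EllTwo.ext fun y => congrFun (s.indicator_add v w) y
  map_smul' r v := EllTwo.ext fun y => congrFun (s.indicator_const_smul r v) y

/-- The set function `s ↦ ∑_{y ∈ s} v(y)²`. -/
noncomputable def mass (v : EllTwo Y) (s : Set Y) : ℝ := ‖restrict s v‖ ^ 2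

lemma hasSum_mass (v : EllTwo Y) (s : Set Y) :
    HasSum (s.indicator fun y => v y ^ 2) (mass v s) :=
  (hasSum_sq (restrict s v)).congr_fun fun y => (indicator_sq s v y).symm

lemma mass_univ (v : EllTwo Y) : mass v Set.univ = ‖v‖ ^ 2 :=
  (hasSum_mass v Set.univ).unique (by simpa using hasSum_sq v)

lemma mass_union (v : EllTwo Y) {s t : Set Y} (h : Disjoint s t) :
    mass v (s ∪ t) = mass v s + mass v t :=
  (hasSum_mass v (s ∪ t)).unique <| by
    rw [Set.indicator_union_of_disjoint h]
    exact (hasSum_mass v s).add (hasSum_mass v t)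

lemma norm_restrict_le (s : Set Y) (v : EllTwo Y) : ‖restrict s v‖ ≤ ‖v‖ := by
  refine le_of_sq_le_sq ?_ (norm_nonneg v)
  exact hasSum_le (Set.indicator_le_self' fun _ _ => sq_nonneg _) (hasSum_mass v s) (hasSum_sq v)

lemma abs_mass_sub_mass_le (v w : EllTwo Y) (s : Set Y) :
    |mass v s - mass w s| ≤ ‖v - w‖ * (‖v‖ + ‖w‖) := by
  have hsub : |‖restrict s v‖ - ‖restrict s w‖| ≤ ‖v - w‖ := by
    refine (abs_norm_sub_norm_le _ _).trans ?_
    rw [← map_sub]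
    exact norm_restrict_le s (v - w)
  rw [mass, mass, sq_sub_sq, mul_comm, abs_mul, abs_of_nonneg (a := ‖_‖ + ‖_‖) (by positivity)]
  gcongr <;> exact norm_restrict_le s _

variable {G : Type*} [Group G] [MulAction G Y]

lemma hasSum_sq_smul (g : G) (v : EllTwo Y) : HasSum (fun y => v (g • y) ^ 2) (‖v‖ ^ 2) :=
  (MulAction.toPerm g).hasSum_iff (f := fun y => v y ^ 2) |>.2 (hasSum_sq v)

/-- The action of `G` on `ℓ²(Y)` by translation. -/
noncomputable def translation (g : G) : EllTwo Y ≃ₗᵢ[ℝ] EllTwo Y where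
  toFun v := EllTwo.mk (hasSum_sq_smul g⁻¹ v).summable
  invFun v := EllTwo.mk (hasSum_sq_smul g v).summable
  map_add' _ _ := rfl
  map_smul' _ _ := rfl
  left_inv v := EllTwo.ext fun y => by simp
  right_inv v := EllTwo.ext fun y => by simp
  norm_map' v :=
    (sq_eq_sq₀ (norm_nonneg _) (norm_nonneg _)).1 ((hasSum_sq _).unique (hasSum_sq_smul g⁻¹ v))

lemma translation_apply (g : G) (v : EllTwo Y) (y : Y) : translation g v y = v (g⁻¹ • y) := rfl

lemma translation_inv (g : G) : (translation g⁻¹ : EllTwo Y ≃ₗᵢ[ℝ] EllTwo Y) = (translation g)⁻¹ :=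
  LinearIsometryEquiv.ext fun v => lp.ext <| funext fun y => by
    rw [translation_apply, inv_inv]
    rfl

lemma mass_translation (g : G) (v : EllTwo Y) (s : Set Y) :
    mass (translation g v) s = mass v (g⁻¹ • s) := by
  refine (hasSum_mass _ s).unique ?_
  convert (MulAction.toPerm g⁻¹).hasSum_iff.2 (hasSum_mass v (g⁻¹ • s)) using 1
  ext y
  by_cases hy : y ∈ s <;> simp [hy, translation_apply]

end EllTwo

section Mean

/-- A finitely additive probability measure, or mean, defined on all subsets of `Y`. -/
structure IsMean {Y : Type*} (m : Set Y → ℝ) : Prop where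
  nonneg : ∀ s, 0 ≤ m s
  univ : m Set.univ = 1
  union : ∀ {s t}, Disjoint s t → m (s ∪ t) = m s + m t

/-- The action of `G` on `Y` is amenable: some mean on `Y` is invariant. -/
def HasInvariantMean (G Y : Type*) [Group G] [MulAction G Y] : Prop :=
  ∃ m : Set Y → ℝ, IsMean m ∧ ∀ (g : G) (s : Set Y), m (g • s) = m s

variable {Y : Type*} {m : Set Y → ℝ}

lemma IsMean.mono (hm : IsMean m) {s t : Set Y} (h : s ⊆ t) : m s ≤ m t := by
  rw [← Set.union_sdiff_cancel h, hm.union Set.disjoint_sdiff_right]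
  exact le_add_of_nonneg_right (hm.nonneg _)

lemma IsMean.mem_Icc (hm : IsMean m) (s : Set Y) : m s ∈ Set.Icc 0 1 :=
  ⟨hm.nonneg s, hm.univ ▸ hm.mono s.subset_univ⟩

lemma IsMean.empty (hm : IsMean m) : m ∅ = 0 := by
  simpa using hm.union (Set.disjoint_empty ∅)

lemma IsMean.union_le (hm : IsMean m) (s t : Set Y) : m (s ∪ t) ≤ m s + m t := by
  rw [← Set.union_sdiff_self, hm.union Set.disjoint_sdiff_right]
  gcongr
  exact hm.mono Set.sdiff_subset

lemma IsMean.biUnion_le (hm : IsMean m) {ι : Type*} (I : Finset ι) (s : ι → Set Y) :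
    m (⋃ i ∈ I, s i) ≤ ∑ i ∈ I, m (s i) := by
  classical
  induction I using Finset.induction_on with
  | empty => simp [hm.empty]
  | insert i I hi ih =>
    rw [Finset.set_biUnion_insert, Finset.sum_insert hi]
    exact (hm.union_le _ _).trans (by gcongr)

lemma isMean_mass {v : EllTwo Y} (hv : ‖v‖ = 1) : IsMean (mass v) where
  nonneg _ := sq_nonneg _
  univ := by rw [mass_univ, hv, one_pow]
  union := mass_union v

/-- Means form a compact set for pointwise convergence. -/
lemma exists_isMean_tendsto_hyperfilter {m : ℕ → Set Y → ℝ} (hm : ∀ n, IsMean (m n)) :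
    ∃ μ, IsMean μ ∧ ∀ s, Tendsto (fun n => m n s) (hyperfilter ℕ) (𝓝 (μ s)) := by
  have hlim : ∀ s, ∃ r, Tendsto (fun n => m n s) (hyperfilter ℕ) (𝓝 r) := fun s => by
    obtain ⟨r, -, hr⟩ := isCompact_Icc.ultrafilter_le_nhds ((hyperfilter ℕ).map fun n : ℕ => m n s)
      (tendsto_principal.2 (Eventually.of_forall fun n : ℕ => (hm n).mem_Icc s))
    exact ⟨r, hr⟩
  choose μ hμ using hlim
  refine ⟨μ, ⟨fun s => ?_, ?_, fun {s t} hst => ?_⟩, hμ⟩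
  · exact ge_of_tendsto (hμ s) (Eventually.of_forall fun n => (hm n).nonneg s)
  · exact tendsto_nhds_unique (hμ _) (tendsto_const_nhds.congr fun n => (hm n).univ.symm)
  · exact tendsto_nhds_unique (hμ _)
      (((hμ s).add (hμ t)).congr fun n => ((hm n).union hst).symm)

lemma IsMean.isAmenable_of_injective {Q : Type*} [Group Q] (hm : IsMean m) {ι : Q → Y}
    (hι : Function.Injective ι) (hpos : 0 < m (Set.range ι))
    (hinv : ∀ (q : Q) (s : Set Q), m (ι '' (q • s)) = m (ι '' s)) : IsAmenable Q := by
  refine ⟨fun s => m (ι '' s) / m (Set.range ι), fun s => div_nonneg (hm.nonneg _) hpos.le, ?_,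
    fun s t hst => ?_, fun q s => congrArg (· / _) (hinv q s)⟩
  · beta_reduce
    rw [Set.image_univ, div_self hpos.ne']
  · beta_reduce
    rw [Set.image_union, hm.union ((Set.disjoint_image_iff hι).2 hst), add_div]

variable {G X : Type*} [Group G] {a : X → G} {σ : Equiv.Perm X}

/-- Two letters move an `F` as here in the same way; hence averaging `F` over one step of the walk
makes it invariant. -/
lemma add_smul_invariant {α B : Type*} [MulAction G α] [AddCommMonoid B] {F : α → B}
    (hσ : ∀ x, a (σ x) = (a x)⁻¹) (hgen : Subgroup.closure (Set.range a) = ⊤)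
    (hF : ∀ x x' y, F (a x • y) = F (a x' • y)) (x₀ : X) (g : G) (y : α) :
    F (g • y) + F (a x₀ • g • y) = F y + F (a x₀ • y) := by
  have hg : g ∈ Subgroup.closure (Set.range a) := hgen ▸ Subgroup.mem_top g
  induction hg using Subgroup.closure_induction generalizing y with
  | mem g hg =>
    obtain ⟨x, rfl⟩ := hg
    rw [hF x₀ (σ x) (a x • y), hσ, inv_smul_smul, add_comm, hF x x₀ y]
  | one => simp
  | mul g h _ _ hg hh => rw [mul_smul, hg, hh]
  | inv g _ hg => simpa using (hg (g⁻¹ • y)).symm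

variable [MulAction G Y]

lemma IsMean.hasInvariantMean (hm : IsMean m) (hσ : ∀ x, a (σ x) = (a x)⁻¹)
    (hgen : Subgroup.closure (Set.range a) = ⊤) (ha : ∀ x x' s, m (a x • s) = m (a x' • s))
    (x₀ : X) : HasInvariantMean G Y := by
  refine ⟨fun s => (m s + m (a x₀ • s)) / 2, ⟨fun s => ?_, ?_, fun hst => ?_⟩, fun g s => ?_⟩
  · have := hm.nonneg s
    have := hm.nonneg (a x₀ • s)
    positivity
  · simp [hm.univ]
  · rw [Set.smul_set_union, hm.union hst, hm.union (Set.disjoint_smul_set.2 hst)]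
    ring
  · simp only [add_smul_invariant hσ hgen ha x₀ g s]

lemma IsMean.pos_of_forall_exists_mem_smul {I : Type*} [Finite I] (hm : IsMean m)
    (hinv : ∀ (g : G) (s : Set Y), m (g • s) = m s) {s : Set Y} {b : I → G}
    (h : ∀ y, ∃ i, y ∈ b i • s) : 0 < m s := by
  have := Fintype.ofFinite I
  have hle := hm.biUnion_le Finset.univ fun i => b i • s
  have hcover : ⋃ i ∈ Finset.univ, b i • s = Set.univ := by simpa [Set.eq_univ_iff_forall] using h
  simp only [hcover, hm.univ, hinv, Finset.sum_const, nsmul_eq_mul] at hle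
  refine (hm.nonneg s).lt_of_ne fun hzero => ?_
  rw [← hzero, mul_zero] at hle
  exact absurd hle (by norm_num)

end Mean

/-! ### Random walks -/

section Walk

variable {G X Y : Type*} [Group G] [MulAction G Y] {a : X → G} {σ : Equiv.Perm X}

lemma eq_zero_of_translation_eq [Infinite Y] [MulAction.IsPretransitive G Y] [Nonempty X]
    (hσ : ∀ x, a (σ x) = (a x)⁻¹) (hgen : Subgroup.closure (Set.range a) = ⊤) {v : EllTwo Y}
    (hv : ∀ x x', translation (a x) v = translation (a x') v) : v = 0 := by
  obtain ⟨x₀⟩ := ‹Nonempty X›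
  have hsq : ∀ x x' y, v (a x • y) ^ 2 = v (a x' • y) ^ 2 := fun x x' y => by
    have h := congrArg (fun u : EllTwo Y => u y) (hv (σ x) (σ x'))
    simp only [translation_apply, hσ, inv_inv] at h
    rw [h]
  have hsum := (hasSum_sq v).summable.add (hasSum_sq_smul (a x₀) v).summable
  ext y
  have hconst : ∀ y', v y' ^ 2 + v (a x₀ • y') ^ 2 = v y ^ 2 + v (a x₀ • y) ^ 2 := fun y' => by
    obtain ⟨g, rfl⟩ := MulAction.exists_smul_eq G y y'
    exact add_smul_invariant (F := fun y => v y ^ 2) hσ hgen hsq x₀ g y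
  simp only [hconst, summable_const_iff] at hsum
  have : v y ^ 2 = 0 := by linarith [sq_nonneg (v y), sq_nonneg (v (a x₀ • y))]
  simpa using this

variable [Fintype X]

variable (Y) in
/-- The Markov operator on `ℓ²(Y)` of the random walk with steps `a x`, where `x` is a uniformly
distributed letter. -/
noncomputable def walkOperator (a : X → G) : EllTwo Y →L[ℝ] EllTwo Y :=
  averageOperator fun x => translation (a x)

lemma tendsto_walkOperator_pow [Infinite Y] [MulAction.IsPretransitive G Y] [Nonempty X]
    (hσ : ∀ x, a (σ x) = (a x)⁻¹) (hgen : Subgroup.closure (Set.range a) = ⊤) (v : EllTwo Y) :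
    Tendsto (fun n => (walkOperator Y a ^ n) v) atTop (𝓝 0) :=
  tendsto_pow_apply_zero (isSymmetric_averageOperator _ fun x => by rw [hσ, translation_inv])
    (norm_averageOperator_apply_le _)
    (fun _ h => eq_zero_of_translation_eq hσ hgen (apply_eq_apply_of_norm_averageOperator_eq _ h)) v

/-- Kesten's criterion: almost invariant unit vectors `v` give means `s ↦ ∑_{y ∈ s} v(y)²`, and
these accumulate at an invariant one. -/
lemma norm_walkOperator_lt_one [Nonempty X] (hσ : ∀ x, a (σ x) = (a x)⁻¹)
    (hgen : Subgroup.closure (Set.range a) = ⊤) (h : ¬ HasInvariantMean G Y) :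
    ‖walkOperator Y a‖ < 1 := by
  by_contra! hone
  choose v hv hvx using fun n : ℕ =>
    exists_norm_eq_one_forall_norm_sub_lt _ hone (Nat.one_div_pos_of_nat (α := ℝ) (n := n))
  obtain ⟨m, hm, hlim⟩ := exists_isMean_tendsto_hyperfilter fun n => isMean_mass (hv n)
  refine h (hm.hasInvariantMean hσ hgen (fun x x' s => ?_) (Classical.arbitrary X))
  have hdist : ∀ n, |mass (v n) (a x • s) - mass (v n) (a x' • s)| ≤ 1 / ((n : ℝ) + 1) * 2 := by
    intro n
    have hmass : ∀ x, mass (v n) (a x • s) = mass (translation (a (σ x)) (v n)) s := fun x => by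
      rw [mass_translation, hσ, inv_inv]
    rw [hmass, hmass]
    refine (abs_mass_sub_mass_le _ _ s).trans ?_
    rw [LinearIsometryEquiv.norm_map, LinearIsometryEquiv.norm_map, hv, one_add_one_eq_two]
    gcongr
    exact (hvx n _ _).le
  have hzero : Tendsto (fun n : ℕ => 1 / ((n : ℝ) + 1) * 2) (hyperfilter ℕ) (𝓝 0) := by
    simpa using (tendsto_one_div_add_atTop_nhds_zero_nat.mul_const (2 : ℝ)).mono_left
      Nat.hyperfilter_le_atTop
  exact sub_eq_zero.1 (tendsto_nhds_unique ((hlim _).sub (hlim _))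
    (squeeze_zero_norm hdist hzero))

end Walk

/-! ### Counting words -/

section Words

/-- The words of length `n`. -/
def wordsOfLength (X : Type*) [Fintype X] : ℕ → Finset (List X)
  | 0 => {[]}
  | n + 1 => (Finset.univ ×ˢ wordsOfLength X n).map
      ⟨fun p => p.1 :: p.2, fun _ _ h => Prod.ext_iff.2 (List.cons.inj h)⟩

variable {X : Type*} [Fintype X]

@[simp] lemma mem_wordsOfLength {n : ℕ} {w : List X} : w ∈ wordsOfLength X n ↔ w.length = n := by
  induction n generalizing w with
  | zero => simp [wordsOfLength]
  | succ n ih => cases w with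
    | nil => simp [wordsOfLength]
    | cons x w => simp [wordsOfLength, ih, DFunLike.coe]

lemma sum_wordsOfLength_succ {M : Type*} [AddCommMonoid M] (n : ℕ) (F : List X → M) :
    ∑ w ∈ wordsOfLength X (n + 1), F w = ∑ x, ∑ w ∈ wordsOfLength X n, F (x :: w) := by
  rw [wordsOfLength, Finset.sum_map, Finset.sum_product]
  rfl

lemma card_wordsOfLength (n : ℕ) : (wordsOfLength X n).card = Fintype.card X ^ n := by
  induction n with
  | zero => rfl
  | succ n ih => simp [wordsOfLength, ih, pow_succ']

lemma walkOperator_pow_apply {G Y : Type*} [Group G] [MulAction G Y] (a : X → G) (n : ℕ)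
    (v : EllTwo Y) (z : Y) : (walkOperator Y a ^ n) v z =
      (∑ w ∈ wordsOfLength X n, v ((w.map a).prod⁻¹ • z)) / (Fintype.card X : ℝ) ^ n := by
  have hstep : ∀ (u : EllTwo Y) z,
      walkOperator Y a u z = (∑ x, u ((a x)⁻¹ • z)) / Fintype.card X := fun u z => by
    rw [walkOperator, averageOperator_apply, lp.coeFn_smul, lp.coeFn_sum, Pi.smul_apply,
      Finset.sum_apply, smul_eq_mul, inv_mul_eq_div]
    rfl
  induction n generalizing z with
  | zero => simp [wordsOfLength]
  | succ n ih =>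
    rw [pow_succ', mul_apply_eq_comp, hstep, sum_wordsOfLength_succ, pow_succ, ← div_div,
      Finset.sum_div]
    simp only [ih, List.map_cons, List.prod_cons, mul_inv_rev, mul_smul, Finset.sum_div]

end Words

section Density

lemma sum_range_pow_le {x : ℝ} (hx : 3 / 2 ≤ x) (n : ℕ) :
    ∑ j ∈ Finset.range (n + 1), x ^ j ≤ 3 * x ^ n := by
  induction n with
  | zero => simp
  | succ n ih =>
    have : (3 / 2) * x ^ n ≤ x * x ^ n := by gcongr
    rw [Finset.sum_range_succ, pow_succ']
    linarith

variable {X : Type} [Fintype X]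

open Classical in
/-- The number of words of length `n` in `S`. -/
noncomputable def wordCount (S : Set (List X)) (n : ℕ) : ℕ := {w ∈ wordsOfLength X n | w ∈ S}.card

lemma ncard_words_le (S : Set (List X)) (n : ℕ) :
    {w | w ∈ S ∧ w.length ≤ n}.ncard = ∑ j ∈ Finset.range (n + 1), wordCount S j := by
  classical
  have hunion : {w | w ∈ S ∧ w.length ≤ n} =
      ((Finset.range (n + 1)).biUnion fun j => {w ∈ wordsOfLength X j | w ∈ S} :
        Finset (List X)) := by
    ext w
    simp [and_comm]
  rw [hunion, Set.ncard_coe_finset, Finset.card_biUnion]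
  · rfl
  · intro i _ j _ hij
    refine Finset.disjoint_left.2 fun w hi hj => hij ?_
    simp only [Finset.mem_filter, mem_wordsOfLength] at hi hj
    exact hi.1.symm.trans hj.1

lemma wordCount_univ (n : ℕ) : wordCount (Set.univ : Set (List X)) n = Fintype.card X ^ n := by
  simp [wordCount, card_wordsOfLength]

lemma wordCount_add_wordCount_compl (S : Set (List X)) (n : ℕ) :
    wordCount S n + wordCount Sᶜ n = Fintype.card X ^ n := by
  classical
  rw [← card_wordsOfLength, ← Finset.card_filter_add_card_filter_not (· ∈ S)]
  simp only [wordCount, Set.mem_compl_iff]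

variable (S : Set (List X))

lemma density_eq (n : ℕ) : density S n = (∑ j ∈ Finset.range (n + 1), (wordCount S j : ℝ)) /
    ∑ j ∈ Finset.range (n + 1), (Fintype.card X : ℝ) ^ j := by
  have hall := ncard_words_le (Set.univ : Set (List X)) n
  simp only [Set.mem_univ, true_and, wordCount_univ] at hall
  rw [density, ncard_words_le, hall]
  push_cast
  rfl

variable [Nonempty X]

lemma sum_card_pow_pos (n : ℕ) : 0 < ∑ j ∈ Finset.range (n + 1), (Fintype.card X : ℝ) ^ j :=
  Finset.sum_pos (fun _ _ => pow_pos (Nat.cast_pos.2 Fintype.card_pos) _) ⟨0, by simp⟩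

omit [Fintype X] in
lemma one_sub_density [Finite X] (n : ℕ) : 1 - density S n = density Sᶜ n := by
  have := Fintype.ofFinite X
  have hadd : ∀ j, (wordCount S j : ℝ) + wordCount Sᶜ j = (Fintype.card X : ℝ) ^ j :=
    fun j => mod_cast wordCount_add_wordCount_compl S j
  rw [sub_eq_iff_eq_add', density_eq, density_eq, ← add_div, ← Finset.sum_add_distrib,
    eq_div_iff (sum_card_pow_pos n).ne', one_mul]
  simp only [hadd]

variable {S}

lemma isGeneric_of_tendsto_wordCount_compl
    (h : Tendsto (fun n => (wordCount Sᶜ n : ℝ) / (Fintype.card X : ℝ) ^ n) atTop (𝓝 0)) :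
    IsGeneric S := by
  have hpos : ∀ n, (0 : ℝ) < (Fintype.card X : ℝ) ^ n := fun n =>
    pow_pos (Nat.cast_pos.2 Fintype.card_pos) n
  have hlittle : (fun n => (wordCount Sᶜ n : ℝ)) =o[atTop] fun n => (Fintype.card X : ℝ) ^ n :=
    Asymptotics.isLittleO_of_tendsto (fun n hn => absurd hn (hpos n).ne') h
  have hdiv : Tendsto (fun n => ∑ j ∈ Finset.range n, (Fintype.card X : ℝ) ^ j) atTop atTop := by
    refine tendsto_atTop_mono (fun n => ?_) tendsto_natCast_atTop_atTop
    simpa using Finset.card_nsmul_le_sum (Finset.range n) _ (1 : ℝ) fun j _ =>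
      one_le_pow₀ (Nat.one_le_cast.2 Fintype.card_pos)
  have hcompl : Tendsto (density Sᶜ) atTop (𝓝 0) :=
    ((hlittle.sum_range (fun n => (hpos n).le) hdiv).tendsto_div_nhds_zero.comp
      (tendsto_add_atTop_nat 1)).congr fun n => (density_eq Sᶜ n).symm
  simpa [IsGeneric, ← one_sub_density] using hcompl.const_sub 1

/-- The rate of decay is only kept down to `3 / 4`, so that the sums over the lengths up to `n` are
dominated by their last term. -/
lemma isStronglyGeneric_of_wordCount_compl_le [Nontrivial X] {ρ K : ℝ} (hρ : 0 ≤ ρ) (hρ1 : ρ < 1)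
    (hK : 0 < K) (h : ∀ n, (wordCount Sᶜ n : ℝ) / (Fintype.card X : ℝ) ^ n ≤ K * ρ ^ n) :
    IsStronglyGeneric S := by
  have hgen : IsGeneric S := isGeneric_of_tendsto_wordCount_compl <|
    squeeze_zero (fun n => by positivity) h <| by
      simpa using (tendsto_pow_atTop_nhds_zero_of_lt_one hρ hρ1).const_mul K
  set d : ℝ := (Fintype.card X : ℝ)
  set σ : ℝ := max ρ (3 / 4)
  have hd : 2 ≤ d := Nat.ofNat_le_cast.2 Fintype.one_lt_card
  have hσ : 3 / 4 ≤ σ := le_max_right _ _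
  have hσd : 3 / 2 ≤ σ * d := by nlinarith
  refine ⟨hgen, σ, 3 * K, by positivity, max_lt hρ1 (by norm_num), by positivity, fun n _ => ?_⟩
  rw [one_sub_density, density_eq, div_le_iff₀ (sum_card_pow_pos n)]
  calc ∑ j ∈ Finset.range (n + 1), (wordCount Sᶜ j : ℝ)
      ≤ ∑ j ∈ Finset.range (n + 1), K * (σ * d) ^ j := by
        refine Finset.sum_le_sum fun j _ => ?_
        rw [mul_pow, ← mul_assoc, ← div_le_iff₀ (by positivity)]
        exact (h j).trans (by gcongr; exact le_max_left _ _)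
    _ ≤ K * (3 * (σ * d) ^ n) := by
        rw [← Finset.mul_sum]
        gcongr
        exact sum_range_pow_le hσd n
    _ = 3 * K * σ ^ n * d ^ n := by ring
    _ ≤ 3 * K * σ ^ n * ∑ j ∈ Finset.range (n + 1), d ^ j := by
        gcongr
        exact Finset.single_le_sum (f := fun j => d ^ j) (fun j _ => by positivity)
          (Finset.self_mem_range_succ n)

end Density

section Return

/-- The indicator function of a finite set. -/
noncomputable def EllTwo.indicator {Y : Type*} (A : Finset Y) : EllTwo Y :=
  .mk (f := (A : Set Y).indicator fun _ => 1) <|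
    summable_of_hasFiniteSupport <| A.finite_toSet.subset fun y hy => by_contra fun hyA => hy <| by
      simp [Set.indicator_of_notMem hyA]

variable {X : Type} [Fintype X] {G Y : Type*} [Group G] [MulAction G Y] {a : X → G}
  {σ : Equiv.Perm X} {S : Set (List X)} {A : Finset Y} {z : Y}

/-- The walk brings `z` to `A` in `n` steps with the probability `(walkOperator Y a ^ n) 1_A z`. -/
lemma wordCount_compl_div_le (hS : ∀ w ∉ S, (w.map a).prod⁻¹ • z ∈ A) (n : ℕ) :
    (wordCount Sᶜ n : ℝ) / (Fintype.card X : ℝ) ^ n ≤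
      ‖(walkOperator Y a ^ n) (EllTwo.indicator A)‖ := by
  classical
  refine le_trans ?_ ((le_abs_self _).trans (lp.norm_apply_le_norm two_ne_zero
    ((walkOperator Y a ^ n) (EllTwo.indicator A)) z))
  rw [walkOperator_pow_apply]
  gcongr
  rw [wordCount, Finset.card_filter]
  push_cast
  refine Finset.sum_le_sum fun w _ => ?_
  by_cases hw : w ∈ S
  · simpa [hw, EllTwo.indicator] using Set.indicator_nonneg (fun _ _ => zero_le_one) _
  · simp [hw, EllTwo.indicator, hS w hw]

omit [Fintype X] in
lemma isGeneric_of_walk_mem [Finite X] [Nonempty X] [Infinite Y] [MulAction.IsPretransitive G Y]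
    (hσ : ∀ x, a (σ x) = (a x)⁻¹) (hgen : Subgroup.closure (Set.range a) = ⊤)
    (hS : ∀ w ∉ S, (w.map a).prod⁻¹ • z ∈ A) : IsGeneric S :=
  have := Fintype.ofFinite X
  isGeneric_of_tendsto_wordCount_compl <|
    squeeze_zero (fun n => by positivity) (wordCount_compl_div_le hS)
      (tendsto_zero_iff_norm_tendsto_zero.1 (tendsto_walkOperator_pow hσ hgen _))

omit [Fintype X] in
lemma isStronglyGeneric_of_walk_mem [Finite X] [Nontrivial X] (h : ¬ HasInvariantMean G Y)
    (hσ : ∀ x, a (σ x) = (a x)⁻¹) (hgen : Subgroup.closure (Set.range a) = ⊤)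
    (hS : ∀ w ∉ S, (w.map a).prod⁻¹ • z ∈ A) : IsStronglyGeneric S := by
  have := Fintype.ofFinite X
  have hpow : ∀ n, ‖(walkOperator Y a ^ n) (EllTwo.indicator A)‖ ≤
      ‖EllTwo.indicator A‖ * ‖walkOperator Y a‖ ^ n := fun n => by
    induction n with
    | zero => simp
    | succ n ih =>
      rw [pow_succ', mul_apply_eq_comp, pow_succ', mul_left_comm]
      exact (ContinuousLinearMap.le_opNorm _ _).trans (by gcongr)
  refine isStronglyGeneric_of_wordCount_compl_le (norm_nonneg _)
    (norm_walkOperator_lt_one hσ hgen h) (K := ‖EllTwo.indicator A‖ + 1) (by positivity) fun n => ?_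
  exact ((wordCount_compl_div_le hS n).trans (hpow n)).trans (by gcongr; simp)

end Return

/-! ### Letter-to-letter rewriting by a reversible automaton -/

section Transducer

variable {X Z R : Type}

/-- Rewrite a word letter by letter, where the letter written depends on the letter read and on
the state of an automaton all of whose letters permute the states. -/
def transduce (step : X → Equiv.Perm R) (out : R → X → Z) : R → List X → List Z
  | _, [] => []
  | r, x :: w => out r x :: transduce step out (step x r) w

/-- The state of the automaton after reading a word. -/
def stateAfter (step : X → Equiv.Perm R) (r : R) (w : List X) : R :=
  w.foldl (fun r x => step x r) r

variable (step : X → Equiv.Perm R) (out : R → X → Z)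

@[simp] lemma length_transduce (r : R) (w : List X) :
    (transduce step out r w).length = w.length := by
  induction w generalizing r with
  | nil => rfl
  | cons x w ih => simp [transduce, ih]

lemma getElem?_transduce (r : R) (w : List X) (p : ℕ) :
    (transduce step out r w)[p]? = w[p]?.map (out (stateAfter step r (w.take p))) := by
  induction w generalizing r p with
  | nil => simp [transduce]
  | cons x w ih =>
    cases p with
    | zero => simp [transduce, stateAfter]
    | succ p => simpa [transduce, stateAfter] using ih (step x r) p

lemma stateAfter_take_succ (r : R) {w : List X} {p : ℕ} {x : X} (h : w[p]? = some x) :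
    stateAfter step r (w.take (p + 1)) = step x (stateAfter step r (w.take p)) := by
  rw [List.take_add_one, h]
  simp [stateAfter]

/-- What the rewritten tape shows where the original one shows a given symbol. -/
def InputSymbol.rewrite (r : R) : InputSymbol X → InputSymbol Z
  | .leftEnd => .leftEnd
  | .letter x => .letter (out r x)
  | .rightEnd => .rightEnd

/-- The state of the automaton just before the scanned cell, computed from the state `r` recorded
when the head arrived there; the flag says that the head came from the right. -/
def stateBefore (r : R) : Bool → InputSymbol X → R
  | true, .letter x => (step x).symm r
  | _, _ => r

/-- The recorded state and flag after a movement of the head, from the state of the automaton just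
before the scanned cell. -/
def trackMove (r : R) : InputSymbol X → Move → R × Bool
  | .letter x, .right => (step x r, false)
  | .letter _, .left => (r, true)
  | .rightEnd, .left => (r, true)
  | _, _ => (r, false)

/-- The recorded state and flag agree with the position of the head: if it came from the right, then
the scanned cell has already been read. -/
structure Tracks (r₀ : R) (w : List X) (p : ℕ) (t : R × Bool) : Prop where
  le_length : p ≤ w.length + 1
  fromRight : t.2 = true → p ≤ w.length ∧ t.1 = stateAfter step r₀ (w.take p)
  fromLeft : t.2 = false → t.1 = stateAfter step r₀ (w.take (p - 1))

variable {step}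

lemma Tracks.stateBefore_eq {r₀ : R} {w : List X} {p : ℕ} {t : R × Bool}
    (h : Tracks step r₀ w p t) :
    stateBefore step t.1 t.2 (inputAt w p) = stateAfter step r₀ (w.take (p - 1)) := by
  obtain ⟨r, b⟩ := t
  cases b with
  | false => exact h.fromLeft rfl
  | true =>
    obtain ⟨hp, hr⟩ : p ≤ w.length ∧ r = stateAfter step r₀ (w.take p) := h.fromRight rfl
    cases p with
    | zero => simpa [inputAt, stateBefore] using hr
    | succ p =>
      have hx : w[p]? = some (w[p]'(by omega)) := List.getElem?_eq_getElem (by omega)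
      rw [stateAfter_take_succ step r₀ hx] at hr
      simp [inputAt, hx, stateBefore, hr]

lemma inputAt_transduce (r₀ : R) (w : List X) (p : ℕ) :
    inputAt (transduce step out r₀ w) p =
      (inputAt w p).rewrite out (stateAfter step r₀ (w.take (p - 1))) := by
  cases p with
  | zero => rfl
  | succ p =>
    simp only [inputAt, getElem?_transduce]
    cases h : w[p]? <;> simp [InputSymbol.rewrite]

lemma Tracks.move {r₀ : R} {w : List X} {p : ℕ} (hp : p ≤ w.length + 1) (m : Move) :
    Tracks step r₀ w (moveInput w.length m p)
      (trackMove step (stateAfter step r₀ (w.take (p - 1))) (inputAt w p) m) := by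
  cases p with
  | zero => cases m <;> constructor <;> simp [inputAt, trackMove, moveInput]
  | succ p =>
    cases h : w[p]? with
    | none =>
      have hl : w.length ≤ p := by simpa using h
      obtain rfl : p = w.length := by omega
      cases m <;> constructor <;> simp [inputAt, trackMove, moveInput]
    | some x =>
      have hl : p < w.length := (List.getElem?_eq_some_iff.1 h).1
      simp only [inputAt, h, add_tsub_cancel_right]
      cases m with
      | left => exact ⟨hl.le.trans (Nat.le_succ _), fun _ => ⟨hl.le, rfl⟩, nofun⟩
      | stay => exact ⟨hp, nofun, fun _ => rfl⟩
      | right =>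
        have hm : min (p + 1 + 1) (w.length + 1) = p + 2 := by omega
        simp only [trackMove, moveInput, hm]
        exact ⟨Nat.succ_le_succ hl, nofun, fun _ => (stateAfter_take_succ step r₀ h).symm⟩

end Transducer

/-! ### Running a machine on a rewritten word -/

namespace Machine

variable {X Z R : Type} (M : Machine Z) (step : X → Equiv.Perm R) (out : R → X → Z) (r₀ : R)

open Classical in
/-- A state of `M` with the recorded state of the automaton; a machine has only one rejecting state,
so the record is dropped when `M` rejects. -/
noncomputable def tagState (q : M.State) (t : R × Bool) : Bool ⊕ (M.State × (R × Bool)) :=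
  if q = M.reject then .inl false else .inr (q, t)

lemma tagState_of_ne {M : Machine Z} {q : M.State} (h : q ≠ M.reject) (t : R × Bool) :
    M.tagState q t = .inr (q, t) := by simp [tagState, h]

/-- The machine that runs `M` on the rewritten input without writing that down, and that stops
without an answer where `M` accepts. -/
noncomputable def pullback [Finite R] : Machine X where
  State := Bool ⊕ (M.State × (R × Bool))
  finite_state := by
    have := M.finite_state
    infer_instance
  Sym := M.Sym
  finite_sym := M.finite_sym
  blank := M.blank
  numTapes := M.numTapes
  start := M.tagState M.start (r₀, false)
  accept := .inl true
  reject := .inl false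
  accept_ne_reject := by simp
  delta
    | .inl _, _, _ => ∅
    | .inr (q, t), s, g => {a' | q ≠ M.accept ∧
        ∃ a ∈ M.delta q (s.rewrite out (stateBefore step t.1 t.2 s)) g,
          a' = (M.tagState a.1 (trackMove step (stateBefore step t.1 t.2 s) s a.2.1), a.2)}

variable [Finite R]

lemma isDeterministic_pullback (h : M.IsDeterministic) :
    (M.pullback step out r₀).IsDeterministic := by
  rintro (_ | ⟨q, t⟩) s g
  · exact Set.subsingleton_empty
  · rintro _ ⟨_, a, ha, rfl⟩ _ ⟨_, b, hb, rfl⟩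
    rw [h _ _ _ ha hb]

lemma hasMode_pullback {m : Mode} (h : M.HasMode m) : (M.pullback step out r₀).HasMode m := by
  cases m with
  | deterministic => exact M.isDeterministic_pullback step out r₀ h
  | nondeterministic => trivial

variable {M step out r₀}

/-- The configuration `c'` of the pulled back machine stands for the configuration `c`. -/
def Simulates (w : List X) (c' : (M.pullback step out r₀).Config) (c : M.Config) : Prop :=
  ∃ t : R × Bool, c'.state = M.tagState c.state t ∧ Tracks step r₀ w c.pos t ∧
    c'.pos = c.pos ∧ c'.tapes = c.tapes

lemma simulates_init (w : List X) :
    Simulates w (M.pullback step out r₀).init M.init :=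
  ⟨(r₀, false), rfl, by constructor <;> simp [init, stateAfter], rfl, rfl⟩

lemma Simulates.state_eq_reject_iff {w : List X} {c' : (M.pullback step out r₀).Config}
    {c : M.Config} (h : Simulates w c' c) :
    c'.state = (M.pullback step out r₀).reject ↔ c.state = M.reject := by
  obtain ⟨t, hs, -⟩ := h
  rw [hs]
  by_cases hr : c.state = M.reject <;> simp [tagState, hr, pullback]

lemma Simulates.state_ne_accept {w : List X} {c' : (M.pullback step out r₀).Config}
    {c : M.Config} (h : Simulates w c' c) : c'.state ≠ (M.pullback step out r₀).accept := by
  obtain ⟨t, hs, -⟩ := h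
  rw [hs]
  by_cases hr : c.state = M.reject <;> simp [tagState, hr, pullback]

lemma Simulates.space_eq {w : List X} {c' : (M.pullback step out r₀).Config}
    {c : M.Config} (h : Simulates w c' c) : c'.space = c.space := by
  obtain ⟨t, -, -, -, ht⟩ := h
  unfold Config.space
  rw [ht]
  rfl

lemma Simulates.step_forward {w : List X} {c' d' : (M.pullback step out r₀).Config}
    {c : M.Config} (h : Simulates w c' c) (hd : (M.pullback step out r₀).Step w c' d') :
    ∃ d, M.Step (transduce step out r₀ w) c d ∧ Simulates w d' d := by
  have hrej : c.state ≠ M.reject := fun e => hd.2.1 (h.state_eq_reject_iff.2 e)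
  obtain ⟨q', p', T'⟩ := c'
  obtain ⟨t, hs, htr, hp, hT⟩ := h
  simp only at hs hp hT
  subst hs hp hT
  obtain ⟨-, -, a', ha', rfl⟩ := hd
  simp only [tagState_of_ne hrej] at ha'
  obtain ⟨hacc, a, ha, rfl⟩ := ha'
  rw [htr.stateBefore_eq, ← inputAt_transduce] at ha
  refine ⟨_, ⟨hacc, hrej, a, ha, rfl⟩, _, rfl, ?_, ?_, rfl⟩
  · rw [htr.stateBefore_eq, length_transduce]
    exact .move htr.le_length _
  · simp

lemma Simulates.step_backward {w : List X} {c' : (M.pullback step out r₀).Config}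
    {c d : M.Config} (h : Simulates w c' c) (hd : M.Step (transduce step out r₀ w) c d) :
    ∃ d', (M.pullback step out r₀).Step w c' d' ∧ Simulates w d' d := by
  have hacc' := h.state_ne_accept
  have hrej' : c'.state ≠ (M.pullback step out r₀).reject :=
    fun e => hd.2.1 (h.state_eq_reject_iff.1 e)
  obtain ⟨q', p', T'⟩ := c'
  obtain ⟨t, hs, htr, hp, hT⟩ := h
  simp only at hs hp hT
  subst hs hp hT
  obtain ⟨hacc, hrej, a, ha, rfl⟩ := hd
  refine ⟨_, ⟨hacc', hrej',
    (M.tagState a.1 (trackMove step (stateBefore step t.1 t.2 (inputAt w c.pos))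
      (inputAt w c.pos) a.2.1), a.2), ?_, rfl⟩, _, rfl, ?_, ?_, rfl⟩
  · simp only [tagState_of_ne hrej]
    refine ⟨hacc, a, ?_, rfl⟩
    rw [htr.stateBefore_eq, ← inputAt_transduce]
    exact ha
  · rw [htr.stateBefore_eq, length_transduce]
    exact .move htr.le_length _
  · simp

lemma exists_reaches_of_pullback {w : List X} {n : ℕ} {c' : (M.pullback step out r₀).Config}
    (h : (M.pullback step out r₀).Reaches w n c') :
    ∃ c, M.Reaches (transduce step out r₀ w) n c ∧ Simulates w c' c := by
  induction h with
  | init => exact ⟨_, .init, simulates_init w⟩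
  | step _ hs ih =>
    obtain ⟨c, hc, hsim⟩ := ih
    obtain ⟨d, hd, hsim'⟩ := hsim.step_forward hs
    exact ⟨d, .step hc hd, hsim'⟩

lemma exists_pullback_reaches {w : List X} {n : ℕ} {c : M.Config}
    (h : M.Reaches (transduce step out r₀ w) n c) :
    ∃ c', (M.pullback step out r₀).Reaches w n c' ∧ Simulates w c' c := by
  induction h with
  | init => exact ⟨_, .init, simulates_init w⟩
  | step _ hs ih =>
    obtain ⟨c', hc, hsim⟩ := ih
    obtain ⟨d, hd, hsim'⟩ := hsim.step_backward hs
    exact ⟨d, .step hc hd, hsim'⟩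

lemma not_accepts_pullback (w : List X) : ¬ (M.pullback step out r₀).Accepts w := by
  rintro ⟨n, c', hc, hacc⟩
  obtain ⟨c, -, hsim⟩ := exists_reaches_of_pullback hc
  exact hsim.state_ne_accept hacc

lemma RunsInTime.pullback {w : List X} {N : ℕ}
    (h : M.RunsInTime (transduce step out r₀ w) N) :
    (M.pullback step out r₀).RunsInTime w N := fun n _ hc' =>
  let ⟨c, hc, _⟩ := exists_reaches_of_pullback hc'
  h n c hc

lemma RunsInSpace.pullback {w : List X} {N : ℕ}
    (h : M.RunsInSpace (transduce step out r₀ w) N) :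
    (M.pullback step out r₀).RunsInSpace w N := by
  intro n c' hc
  obtain ⟨c, hc, hsim⟩ := exists_reaches_of_pullback hc
  exact hsim.space_eq ▸ h n c hc

lemma Rejects.pullback {w : List X} (h : M.Rejects (transduce step out r₀ w)) :
    (M.pullback step out r₀).Rejects w := by
  obtain ⟨⟨N, hN⟩, hrej⟩ := h
  refine ⟨⟨N, hN.pullback⟩, fun n c' hc hhalted => ?_⟩
  obtain ⟨c, hc, hsim⟩ := exists_reaches_of_pullback hc
  refine hsim.state_eq_reject_iff.2 (hrej n c hc fun d hd => ?_)
  obtain ⟨d', hd', -⟩ := hsim.step_backward hd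
  exact hhalted d' hd'

lemma not_rejects_pullback {w : List X} (h : M.Accepts (transduce step out r₀ w)) :
    ¬ (M.pullback step out r₀).Rejects w := by
  rintro ⟨-, hrej⟩
  obtain ⟨n, c, hc, hacc⟩ := h
  obtain ⟨c', hc', hsim⟩ := exists_pullback_reaches hc
  refine M.accept_ne_reject (hacc.symm.trans (hsim.state_eq_reject_iff.1 (hrej n c' hc' ?_)))
  intro d' hd'
  obtain ⟨d, hd, -⟩ := hsim.step_forward hd'
  exact hd.1 hacc

end Machine

/-- Only the answer "no" carries over: words outside `D` may be rewritten to elements of `E`. -/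
lemma ComplexityClass.Contains.solvesOn_transduce {C : ComplexityClass} {X Z R : Type} [Finite R]
    {E : Set (List Z)} (hE : C.Contains E) (step : X → Equiv.Perm R) (out : R → X → Z) (r₀ : R)
    {D : Set (List X)} (hD : ∀ w ∈ D, transduce step out r₀ w ∈ E) :
    C.SolvesOn D {w | transduce step out r₀ w ∉ E} := by
  obtain ⟨M, hmode, hcorr, hans, htime, hspace⟩ := hE
  refine ⟨M.pullback step out r₀, M.hasMode_pullback step out r₀ hmode, fun w => ⟨?_, ?_⟩,
    fun w hw => ?_, fun F hF => ?_, fun F hF => ?_⟩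
  · exact fun h => absurd h (Machine.not_accepts_pullback w)
  · intro hrej hw
    rcases (hans (transduce step out r₀ w) trivial).2 with h | h
    · exact Machine.not_rejects_pullback h hrej
    · exact (hcorr _).2 h (hD w hw)
  · have hr : M.Rejects (transduce step out r₀ w) :=
      (hans _ trivial).2.resolve_left fun h => hw ((hcorr _).1 h)
    exact ⟨hr.pullback.1, .inr hr.pullback⟩
  · obtain ⟨f, hf, hle⟩ := htime F hF
    refine ⟨f, hf, fun w _ => ?_⟩
    simpa using (hle (transduce step out r₀ w) trivial).pullback
  · obtain ⟨f, hf, hle⟩ := hspace F hF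
    refine ⟨f, hf, fun w _ => ?_⟩
    simpa using (hle (transduce step out r₀ w) trivial).pullback

/-! ### Reidemeister–Schreier rewriting -/

section Letters

variable {G : Type*} [Group G] {k : ℕ} (π : Fin k → G)

/-- The element represented by a letter. -/
def letterValue (x : Fin k × Bool) : G := if x.2 then π x.1 else (π x.1)⁻¹

/-- The formal inversion of letters. -/
def invLetter : Equiv.Perm (Fin k × Bool) := (Equiv.refl _).prodCongr Equiv.boolNot

lemma letterValue_invLetter (x : Fin k × Bool) :
    letterValue π (invLetter x) = (letterValue π x)⁻¹ := by
  obtain ⟨i, b⟩ := x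
  cases b <;> simp [letterValue, invLetter]

lemma evalWord_eq_prod (w : List (Fin k × Bool)) :
    evalWord π w = (w.map (letterValue π)).prod := rfl

lemma evalWord_cons (x : Fin k × Bool) (w : List (Fin k × Bool)) :
    evalWord π (x :: w) = letterValue π x * evalWord π w := by
  simp [evalWord_eq_prod]

variable {π}

lemma Generates.closure_range_letterValue (h : Generates π) :
    Subgroup.closure (Set.range (letterValue π)) = ⊤ := by
  refine top_unique (h.symm.trans_le (Subgroup.closure_mono ?_))
  rintro _ ⟨i, rfl⟩
  exact ⟨(i, true), rfl⟩

lemma Generates.exists_evalWord_eq (h : Generates π) (g : G) : ∃ w, evalWord π w = g := by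
  have hg : g ∈ Subgroup.closure (Set.range (letterValue π)) :=
    h.closure_range_letterValue ▸ Subgroup.mem_top g
  induction hg using Subgroup.closure_induction_left with
  | one => exact ⟨[], rfl⟩
  | mul_left _ hx _ _ ih =>
    obtain ⟨x, rfl⟩ := hx
    obtain ⟨w, rfl⟩ := ih
    exact ⟨x :: w, evalWord_cons π x w⟩
  | inv_mul_cancel _ hx _ _ ih =>
    obtain ⟨x, rfl⟩ := hx
    obtain ⟨w, rfl⟩ := ih
    exact ⟨invLetter x :: w, by rw [evalWord_cons, letterValue_invLetter]⟩

lemma Generates.nontrivial_letters [Nontrivial G] (h : Generates π) :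
    Nontrivial (Fin k × Bool) := by
  have : Nonempty (Fin k) := by
    by_contra hk
    rw [not_nonempty_iff] at hk
    refine bot_ne_top (α := Subgroup G) ?_
    rw [← h, Set.range_eq_empty, Subgroup.closure_empty]
  infer_instance

lemma evalWord_mem_closure (w : List (Fin k × Bool)) :
    evalWord π w ∈ Subgroup.closure (Set.range π) := by
  refine list_prod_mem (List.forall_mem_map.2 fun x _ => ?_)
  have hx : π x.1 ∈ Subgroup.closure (Set.range π) := Subgroup.subset_closure ⟨x.1, rfl⟩
  split_ifs
  exacts [hx, inv_mem hx]

lemma generates_of_forall_exists_evalWord_eq (h : ∀ g, ∃ w, evalWord π w = g) : Generates π :=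
  top_unique fun g _ => by
    obtain ⟨w, rfl⟩ := h g
    exact evalWord_mem_closure w

end Letters

section Rewriting

variable {G : Type*} [Group G] (H : Subgroup G)

/-- The Schreier cocycle of a subgroup: it moves from the representative of the coset `c` along
`g` and back to a representative. -/
noncomputable def schreier (c : G ⧸ H) (g : G) : H :=
  ⟨c.out⁻¹ * g * (g⁻¹ • c).out, by
    rw [mul_assoc, ← QuotientGroup.eq, QuotientGroup.out_eq', ← smul_eq_mul,
      ← MulAction.Quotient.smul_mk]
    simp⟩

lemma coe_schreier (c : G ⧸ H) (g : G) :
    (schreier H c g : G) = c.out⁻¹ * g * (g⁻¹ • c).out := rfl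

@[simp] lemma schreier_one (c : G ⧸ H) : schreier H c 1 = 1 :=
  Subtype.ext (by simp [coe_schreier])

lemma schreier_mul (c : G ⧸ H) (g h : G) :
    schreier H c (g * h) = schreier H c g * schreier H (g⁻¹ • c) h :=
  Subtype.ext (by simp [coe_schreier, mul_smul, mul_assoc])

lemma exists_schreier_eq (c : G ⧸ H) (h : H) : ∃ g, schreier H c g = h := by
  refine ⟨c.out * h * c.out⁻¹, Subtype.ext ?_⟩
  have hfix : (c.out * h * c.out⁻¹) • c = c :=
    calc (c.out * h * c.out⁻¹) • c = (c.out * h * c.out⁻¹) • (c.out : G ⧸ H) := by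
          rw [QuotientGroup.out_eq']
      _ = ((c.out * h : G) : G ⧸ H) := by
          rw [MulAction.Quotient.smul_coe, smul_eq_mul, inv_mul_cancel_right]
      _ = c := by rw [QuotientGroup.mk_mul_of_mem _ h.2, QuotientGroup.out_eq']
  rw [coe_schreier, inv_smul_eq_iff.2 hfix.symm]
  group

variable [H.FiniteIndex] {k : ℕ} (π : Fin k → G)

/-- A numbering of the cosets, needed because the states of a machine form a type in `Type`. -/
noncomputable def cosetEquiv : G ⧸ H ≃ Fin H.index := Finite.equivFin _

/-- The automaton of Reidemeister–Schreier rewriting: the letter `x` moves the coset `c` to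
`x⁻¹ c`. -/
noncomputable def schreierStep (x : Fin k × Bool) : Equiv.Perm (Fin H.index) :=
  (cosetEquiv H).permCongr (MulAction.toPerm (letterValue π x)⁻¹)

/-- The automaton writes its transitions; they are numbered, and used as positive letters only. -/
noncomputable def schreierOut (r : Fin H.index) (x : Fin k × Bool) :
    Fin (Fintype.card (Fin H.index × (Fin k × Bool))) × Bool :=
  (Fintype.equivFin _ (r, x), true)

variable {H} {Q : Type*} [Group Q] (φ : H →* Q)

/-- The images in `Q` of the Schreier generators of `H`. -/
noncomputable def schreierGenerator (i : Fin (Fintype.card (Fin H.index × (Fin k × Bool)))) : Q :=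
  let (r, x) := (Fintype.equivFin (Fin H.index × (Fin k × Bool))).symm i
  φ (schreier H ((cosetEquiv H).symm r) (letterValue π x))

lemma evalWord_transduce_schreier (c : G ⧸ H) (w : List (Fin k × Bool)) :
    evalWord (schreierGenerator π φ)
        (transduce (schreierStep H π) (schreierOut H) (cosetEquiv H c) w) =
      φ (schreier H c (evalWord π w)) := by
  induction w generalizing c with
  | nil => simp [transduce, evalWord]
  | cons x w ih =>
    have hstep : schreierStep H π x (cosetEquiv H c) =
        cosetEquiv H ((letterValue π x)⁻¹ • c) := by
      simp [schreierStep]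
    rw [transduce, evalWord_cons, hstep, ih, evalWord_cons, schreier_mul, map_mul]
    simp [schreierOut, schreierGenerator, letterValue]

variable {π φ}

lemma generates_schreierGenerator (hφ : Function.Surjective φ) (hπ : Generates π) :
    Generates (schreierGenerator π φ) := by
  refine generates_of_forall_exists_evalWord_eq fun q => ?_
  obtain ⟨h, rfl⟩ := hφ q
  obtain ⟨g, rfl⟩ := exists_schreier_eq H ((1 : G) : G ⧸ H) h
  obtain ⟨w, rfl⟩ := hπ.exists_evalWord_eq g
  exact ⟨_, evalWord_transduce_schreier π φ _ w⟩

variable (π φ)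

/-- The words that Reidemeister–Schreier rewriting turns into words nontrivial in `Q`. -/
def nontrivialRewriting : Set (List (Fin k × Bool)) :=
  {w | φ (schreier H ((1 : G) : G ⧸ H) (evalWord π w)) ≠ 1}

variable {π φ}

lemma solvesOn_nontrivialRewriting (hφ : Function.Surjective φ) {C : ComplexityClass}
    (hQ : WordProblemIn C Q) (hπ : Generates π) :
    C.SolvesOn (wordProblem π) (nontrivialRewriting π φ) := by
  have hmem : ∀ w, transduce (schreierStep H π) (schreierOut H)
      (cosetEquiv H ((1 : G) : G ⧸ H)) w ∈ wordProblem (schreierGenerator π φ) ↔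
        φ (schreier H ((1 : G) : G ⧸ H) (evalWord π w)) = 1 := fun w => by
    rw [← evalWord_transduce_schreier]
    rfl
  have h := (hQ _ _ (generates_schreierGenerator hφ hπ)).solvesOn_transduce
    (D := wordProblem π) _ _ _ fun w hw => (hmem w).2 <| by
      rw [show evalWord π w = 1 from hw, schreier_one, map_one]
  simp only [hmem] at h
  exact h

end Rewriting

/-! ### The action on the cosets of the kernel -/

section Kernel

variable {G Q : Type*} [Group G] [Group Q] {H : Subgroup G} (φ : H →* Q)

/-- The kernel of a homomorphism defined on a subgroup, as a subgroup of the whole group. -/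
def kernelIn : Subgroup G := φ.ker.map H.subtype

variable {φ}

lemma coe_mem_kernelIn {h : H} : (h : G) ∈ kernelIn φ ↔ φ h = 1 := by
  simp [kernelIn]

lemma mk_eq_mk_iff {h h' : H} :
    ((h : G) : G ⧸ kernelIn φ) = ((h' : G) : G ⧸ kernelIn φ) ↔ φ h = φ h' := by
  rw [QuotientGroup.eq, ← Subgroup.coe_inv, ← Subgroup.coe_mul, coe_mem_kernelIn, map_mul, map_inv,
    inv_mul_eq_one]

/-- The quotient `Q` of `H` is `H ⧸ ker φ`, a part of the coset space of the kernel in `G`. -/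
noncomputable def quotientEmbedding (hφ : Function.Surjective φ) : Q ↪ G ⧸ kernelIn φ where
  toFun q := ((Function.surjInv hφ q : H) : G)
  inj' q q' h := by simpa [Function.surjInv_eq] using mk_eq_mk_iff.1 h

lemma quotientEmbedding_apply (hφ : Function.Surjective φ) (h : H) :
    quotientEmbedding hφ (φ h) = ((h : G) : G ⧸ kernelIn φ) :=
  mk_eq_mk_iff.2 (Function.surjInv_eq hφ _)

lemma quotientEmbedding_mul (hφ : Function.Surjective φ) (h : H) (q : Q) :
    quotientEmbedding hφ (φ h * q) = (h : G) • quotientEmbedding hφ q := by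
  obtain ⟨h', rfl⟩ := hφ q
  rw [← map_mul, quotientEmbedding_apply, quotientEmbedding_apply]
  rfl

lemma exists_mem_out_smul_range_quotientEmbedding (hφ : Function.Surjective φ)
    (y : G ⧸ kernelIn φ) : ∃ c : G ⧸ H, y ∈ c.out • Set.range (quotientEmbedding hφ) := by
  obtain ⟨g, rfl⟩ := QuotientGroup.mk_surjective y
  have hg : ((g : G) : G ⧸ H).out⁻¹ * g ∈ H := QuotientGroup.eq.1 (QuotientGroup.out_eq' _)
  exact ⟨g, Set.mem_smul_set_iff_inv_smul_mem.2
    ⟨φ ⟨_, hg⟩, quotientEmbedding_apply hφ ⟨_, hg⟩⟩⟩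

lemma isAmenable_of_hasInvariantMean [H.FiniteIndex] (hφ : Function.Surjective φ)
    (h : HasInvariantMean G (G ⧸ kernelIn φ)) : IsAmenable Q := by
  obtain ⟨m, hm, hinv⟩ := h
  refine hm.isAmenable_of_injective (quotientEmbedding hφ).injective
    (hm.pos_of_forall_exists_mem_smul hinv (exists_mem_out_smul_range_quotientEmbedding hφ))
    fun q s => ?_
  obtain ⟨h, rfl⟩ := hφ q
  rw [← hinv (h : G) (quotientEmbedding hφ '' s)]
  simp only [← Set.image_smul, Set.image_image, smul_eq_mul, quotientEmbedding_mul]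

lemma inv_smul_mk_out_of_schreier {c : G ⧸ H} {g : G} (h : φ (schreier H c g) = 1) :
    g⁻¹ • (c.out : G ⧸ kernelIn φ) = ((g⁻¹ • c).out : G) := by
  rw [← coe_mem_kernelIn, coe_schreier] at h
  rw [MulAction.Quotient.smul_coe, smul_eq_mul, QuotientGroup.eq]
  simpa [mul_assoc] using h

/-- The cosets of `kernelIn φ` of the chosen representatives of the cosets of `H`. -/
noncomputable def representatives (φ : H →* Q) [H.FiniteIndex] : Finset (G ⧸ kernelIn φ) :=
  (Set.finite_range fun c : G ⧸ H => (c.out : G ⧸ kernelIn φ)).toFinset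

variable [H.FiniteIndex] {k : ℕ} {π : Fin k → G}

lemma inv_smul_mem_representatives {w : List (Fin k × Bool)} (hw : w ∉ nontrivialRewriting π φ) :
    (w.map (letterValue π)).prod⁻¹ • (((1 : G) : G ⧸ H).out : G ⧸ kernelIn φ) ∈
      representatives φ := by
  rw [← evalWord_eq_prod, inv_smul_mk_out_of_schreier (not_not.1 hw)]
  simp [representatives]

lemma isGeneric_nontrivialRewriting [Infinite Q] (hφ : Function.Surjective φ) (hπ : Generates π) :
    IsGeneric (nontrivialRewriting π φ) := by
  have : Infinite (G ⧸ kernelIn φ) := .of_injective _ (quotientEmbedding hφ).injective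
  have : Infinite G := .of_surjective _ (QuotientGroup.mk_surjective (s := kernelIn φ))
  have := hπ.nontrivial_letters
  exact isGeneric_of_walk_mem (letterValue_invLetter π) hπ.closure_range_letterValue
    fun w hw => inv_smul_mem_representatives hw

lemma isStronglyGeneric_nontrivialRewriting [Nontrivial Q] (hφ : Function.Surjective φ)
    (hπ : Generates π) (hQ : ¬ IsAmenable Q) : IsStronglyGeneric (nontrivialRewriting π φ) := by
  have : Nontrivial (G ⧸ kernelIn φ) := (quotientEmbedding hφ).injective.nontrivial
  have : Nontrivial G := (QuotientGroup.mk_surjective (s := kernelIn φ)).nontrivial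
  have := hπ.nontrivial_letters
  exact isStronglyGeneric_of_walk_mem (fun h => hQ (isAmenable_of_hasInvariantMean hφ h))
    (letterValue_invLetter π) hπ.closure_range_letterValue
    fun w hw => inv_smul_mem_representatives hw

end Kernel

end GenericComplexity

theorem theoremA {G : Type*} [Group G] [Group.FG G]
    (G₁ : Subgroup G) [G₁.FiniteIndex]
    {Q : Type*} [Group Q] [Infinite Q] (φ : G₁ →* Q) (hφ : Function.Surjective φ)
    (C : GenericComplexity.ComplexityClass) (hQ : GenericComplexity.WordProblemIn C Q) :
    GenericComplexity.WordProblemGenericallyIn C G ∧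
      (¬ GenericComplexity.IsAmenable Q →
        GenericComplexity.WordProblemStronglyGenericallyIn C G) :=
  ⟨fun _ π hπ => ⟨GenericComplexity.nontrivialRewriting π φ,
      GenericComplexity.isGeneric_nontrivialRewriting hφ hπ,
      GenericComplexity.solvesOn_nontrivialRewriting hφ hQ hπ⟩,
    fun hna _ π hπ => ⟨GenericComplexity.nontrivialRewriting π φ,
      GenericComplexity.isStronglyGeneric_nontrivialRewriting hφ hπ hna,
      GenericComplexity.solvesOn_nontrivialRewriting hφ hQ hπ⟩⟩
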